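/- A mixed graph $G$ is obtained from a finite simple graph with non-empty vertex set (the underlying graph) by orienting a subset of its edges. Its Hermitian adjacency matrix is $H(G)=(h_{uv})$, where $h_{uv}=i$ if there is an oriented edge from $u$ to $v$, $h_{uv}=-i$ if there is an oriented edge from $v$ to $u$, $h_{uv}=1$ if $u$ and $v$ are joined by an unoriented edge, and $h_{uv}=0$ otherwise. Let $D(G)$ be the diagonal matrix of the vertex degrees of the underlying graph, and put $Q_H(G)=D(G)+H(G)$ (the Hermitian quasi-Laplacian matrix) and $L_H(G)=D(G)-H(G)$ (the Hermitian Laplacian matrix). For a cycle $C$ of the underlying graph, traversed in one of its two directions, let $a$, $b$, $c$ be the numbers of oriented edges of $C$ that agree with this direction, of oriented edges that are opposite to it, and of unoriented edges. The cycle $C$ is of type III if $\frac{|a-b|}{2}+c$ is an even integer, and of type V if $\frac{|a-b|}{2}$ is an even integer (neither depends on the chosen direction). Suppose that $G$ is connected (that is, its underlying graph is connected). Then 1. $Q_H(G)$ is singular if and only if all cycles of $G$ (if any) are of type III; 2. $L_H(G)$ is singular if and only if all cycles of $G$ (if any) are of type V. Moreover, the "if" parts of 1 and 2 hold for every mixed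 graph $G$ with non-empty vertex set, connected or not. -/

import Mathlib

/-- A mixed graph on `V`: a simple graph in which a subset of the edges has been oriented.
`Arc u v` says that the edge `uv` is oriented from `u` to `v`. -/
structure MixedGraph (V : Type*) where
  /-- The underlying simple graph. -/
  graph : SimpleGraph V
  /-- The oriented edges. -/
  Arc : V → V → Prop
  adj_of_arc : ∀ u v, Arc u v → graph.Adj u v
  not_arc_symm : ∀ u v, Arc u v → ¬ Arc v u

namespace MixedGraph

/-- `u` and `v` are joined by an unoriented edge. -/
def Unoriented {V : Type*} (G : MixedGraph V) (u v : V) : Prop :=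
  G.graph.Adj u v ∧ ¬ G.Arc u v ∧ ¬ G.Arc v u

open Classical in
/-- The Hermitian adjacency matrix `H(G)`. -/
noncomputable def hermitianAdj {V : Type*} (G : MixedGraph V) : Matrix V V ℂ :=
  Matrix.of fun u v =>
    if G.Arc u v then Complex.I
    else if G.Arc v u then -Complex.I
    else if G.Unoriented u v then 1
    else 0

open Classical in
/-- The diagonal matrix `D(G)` of the vertex degrees in the underlying graph. -/
noncomputable def degreeMatrix {V : Type*} [Fintype V] (G : MixedGraph V) : Matrix V V ℂ :=
  Matrix.diagonal fun v => (G.graph.degree v : ℂ)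

/-- The Hermitian Laplacian matrix `L_H(G) = D(G) - H(G)`. -/
noncomputable def laplacian {V : Type*} [Fintype V] (G : MixedGraph V) : Matrix V V ℂ :=
  G.degreeMatrix - G.hermitianAdj

/-- The Hermitian quasi-Laplacian matrix `Q_H(G) = D(G) + H(G)`. -/
noncomputable def quasiLaplacian {V : Type*} [Fintype V] (G : MixedGraph V) : Matrix V V ℂ :=
  G.degreeMatrix + G.hermitianAdj

open Classical in
/-- The number `a` of oriented edges traversed along their orientation. -/
noncomputable def forwardCount {V : Type*} (G : MixedGraph V) {u v : V}
    (C : G.graph.Walk u v) : ℕ :=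
  C.darts.countP fun d => G.Arc d.fst d.snd

open Classical in
/-- The number `b` of oriented edges traversed against their orientation. -/
noncomputable def backwardCount {V : Type*} (G : MixedGraph V) {u v : V}
    (C : G.graph.Walk u v) : ℕ :=
  C.darts.countP fun d => G.Arc d.snd d.fst

open Classical in
/-- The number `c` of unoriented edges traversed. -/
noncomputable def unorientedCount {V : Type*} (G : MixedGraph V) {u v : V}
    (C : G.graph.Walk u v) : ℕ :=
  C.darts.countP fun d => G.Unoriented d.fst d.snd

/-- A cycle is of type III if `|a - b| / 2 + c` is an even integer. The clockwise direction is
the one in which the closed walk `C` runs through the cycle. -/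
def IsTypeIII {V : Type*} (G : MixedGraph V) {v : V} (C : G.graph.Walk v v) : Prop :=
  ∃ k : ℤ, |(G.forwardCount C : ℚ) - G.backwardCount C| / 2 + G.unorientedCount C = 2 * k

/-- A cycle is of type V if `|a - b| / 2` is an even integer. -/
def IsTypeV {V : Type*} (G : MixedGraph V) {v : V} (C : G.graph.Walk v v) : Prop :=
  ∃ k : ℤ, |(G.forwardCount C : ℚ) - G.backwardCount C| / 2 = 2 * k

/-- Every cycle (if any) of `G` is of type III. -/
def AllCyclesTypeIII {V : Type*} (G : MixedGraph V) : Prop :=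
  ∀ (v : V) (C : G.graph.Walk v v), C.IsCycle → G.IsTypeIII C

/-- Every cycle (if any) of `G` is of type V. -/
def AllCyclesTypeV {V : Type*} (G : MixedGraph V) : Prop :=
  ∀ (v : V) (C : G.graph.Walk v v), C.IsCycle → G.IsTypeV C

end MixedGraph

/-!
Both matrices are Laplacians `D - g` of a complex unit gain graph: `g` is a Hermitian matrix
supported on the edges of the underlying graph `Γ`, with entries of modulus one there. For the
Laplacian the gain is `H(G)`, for the quasi-Laplacian it is `-H(G)`.

The Hermitian form of `D - g` is half the sum of `|x u - g u v * x v| ^ 2` over the ordered pairs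
of adjacent vertices, so its kernel consists of the `x` with `x u = g u v * x v` along every
edge (`IsUnitGain.eq_gain_mul_of_gainLaplacian_mulVec_eq_zero`). Following a walk from `u` to `v` then gives
`x u = walkGain g p * x v`. On a connected graph a nonzero such `x` vanishes nowhere, so every
closed walk has gain `1` (`IsUnitGain.walkGain_eq_one_of_det_eq_zero`).

Conversely, if all cycles have gain `1`, then shortening a walk to a path does not change its
gain, so the gain of a walk depends only on its end points (`IsUnitGain.walkGain_eq_of_forall_isCycle`). The
gains of the walks to a fixed root, extended by `0` off the component of the root, form a nonzero
kernel vector (`IsUnitGain.det_gainLaplacian_eq_zero`); here connectedness plays no role.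

Finally, the gain of a walk is `I ^ (a - b)` for `H(G)` and `I ^ (b - a + 2 * c)` for `-H(G)`, and
since `I` is a primitive fourth root of unity, gain `1` on a cycle means type V, respectively
type III.
-/

open Matrix SimpleGraph

/-! ### Gains of walks -/

/-- `g` is a complex unit gain on the graph `Γ`: a Hermitian matrix that vanishes off the edges
and whose entries at edges have modulus one, the latter being phrased as `g u v * g v u = 1`. -/
structure IsUnitGain {V : Type*} (Γ : SimpleGraph V) (g : Matrix V V ℂ) : Prop where
  star_apply : ∀ u v, star (g u v) = g v u
  mul_symm : ∀ u v, Γ.Adj u v → g u v * g v u = 1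
  eq_zero : ∀ u v, ¬ Γ.Adj u v → g u v = 0

/-- The gain of a walk: the product of the gains of its steps. -/
noncomputable def walkGain {V : Type*} {Γ : SimpleGraph V} (g : Matrix V V ℂ) :
    {u v : V} → Γ.Walk u v → ℂ
  | _, _, .nil => 1
  | u, _, .cons (v := w) _ p => g u w * walkGain g p

section Gain

variable {V : Type*} {Γ : SimpleGraph V} {g : Matrix V V ℂ}

theorem walkGain_append {u v w : V} (p : Γ.Walk u v) (q : Γ.Walk v w) :
    walkGain g (p.append q) = walkGain g p * walkGain g q := by
  induction p with
  | nil => simp [walkGain]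
  | cons h p ih => simp [walkGain, ih, mul_assoc]

theorem IsUnitGain.ne_zero (hg : IsUnitGain Γ g) {u v : V} (h : Γ.Adj u v) : g u v ≠ 0 :=
  left_ne_zero_of_mul (hg.mul_symm u v h ▸ one_ne_zero)

theorem IsUnitGain.walkGain_ne_zero (hg : IsUnitGain Γ g) {u v : V} (p : Γ.Walk u v) :
    walkGain g p ≠ 0 := by
  induction p with
  | nil => simp [walkGain]
  | cons h p ih => exact mul_ne_zero (hg.ne_zero h) ih

/-- An edge followed by a path back to its first end is a cycle unless the path is that edge
traversed backwards. -/
theorem IsUnitGain.walkGain_cons_isPath (hg : IsUnitGain Γ g)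
    (hc : ∀ (v : V) (C : Γ.Walk v v), C.IsCycle → walkGain g C = 1)
    {u v : V} (h : Γ.Adj u v) {p : Γ.Walk v u} (hp : p.IsPath) :
    g u v * walkGain g p = 1 := by
  by_cases he : s(v, u) ∈ p.edges
  · rw [hp.eq_adj_toWalk_of_mem_edges he]
    simpa [walkGain] using hg.mul_symm u v h
  · refine hc u (.cons h p) ((Walk.cons_isCycle_iff p h).2 ⟨hp, ?_⟩)
    rwa [Sym2.eq_swap]

theorem IsUnitGain.walkGain_bypass [DecidableEq V] (hg : IsUnitGain Γ g)
    (hc : ∀ (v : V) (C : Γ.Walk v v), C.IsCycle → walkGain g C = 1)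
    {u v : V} (p : Γ.Walk u v) : walkGain g p.bypass = walkGain g p := by
  induction p with
  | nil => rfl
  | @cons u w v h p ih =>
    simp only [Walk.bypass, walkGain]
    split_ifs with hs
    · have hpath := (p.bypass_isPath).takeUntil hs
      rw [← ih]
      conv_rhs => rw [← Walk.take_spec p.bypass hs, walkGain_append, ← mul_assoc,
        hg.walkGain_cons_isPath hc h hpath, one_mul]
    · simp [walkGain, ih]

theorem IsUnitGain.walkGain_eq_one_of_forall_isCycle (hg : IsUnitGain Γ g)
    (hc : ∀ (v : V) (C : Γ.Walk v v), C.IsCycle → walkGain g C = 1)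
    {v : V} (p : Γ.Walk v v) : walkGain g p = 1 := by
  classical
  rw [← hg.walkGain_bypass hc p, (Walk.isPath_iff_nil.1 p.bypass_isPath).eq_nil, walkGain]

/-- When all cycles have gain `1`, the gain of a walk depends only on its end points. -/
theorem IsUnitGain.walkGain_eq_of_forall_isCycle (hg : IsUnitGain Γ g)
    (hc : ∀ (v : V) (C : Γ.Walk v v), C.IsCycle → walkGain g C = 1)
    {u v : V} (p q : Γ.Walk u v) : walkGain g p = walkGain g q := by
  have hp := hg.walkGain_eq_one_of_forall_isCycle hc (p.append q.reverse)
  have hq := hg.walkGain_eq_one_of_forall_isCycle hc (q.append q.reverse)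
  rw [walkGain_append] at hp hq
  exact mul_right_cancel₀ (hg.walkGain_ne_zero q.reverse) (hp.trans hq.symm)

/-! ### The Laplacian of a gain graph -/

open Classical in
/-- The Laplacian `D - g` of the gain `g` on `Γ`, where `D` is the degree matrix of `Γ`. -/
noncomputable def gainLaplacian [Fintype V] (Γ : SimpleGraph V) (g : Matrix V V ℂ) :
    Matrix V V ℂ :=
  (diagonal fun v => (Γ.degree v : ℂ)) - g

open Classical in
theorem IsUnitGain.gainLaplacian_mulVec_apply [Fintype V] (hg : IsUnitGain Γ g) (x : V → ℂ)
    (u : V) :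
    (gainLaplacian Γ g *ᵥ x) u = ∑ v, if Γ.Adj u v then x u - g u v * x v else 0 := by
  have hdeg : (Γ.degree u : ℂ) * x u = ∑ v, if Γ.Adj u v then x u else 0 := by
    rw [← Finset.sum_filter, Finset.sum_const, nsmul_eq_mul, ← card_neighborFinset_eq_degree,
      neighborFinset_eq_filter]
  rw [gainLaplacian, sub_mulVec, Pi.sub_apply, mulVec_diagonal, hdeg, mulVec, dotProduct,
    ← Finset.sum_sub_distrib]
  refine Finset.sum_congr rfl fun v _ => ?_
  split_ifs with h
  · rfl
  · simp [hg.eq_zero u v h]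

open Classical in
/-- The kernel of the Laplacian: the Hermitian form of `D - g` at `x` is half the sum over ordered
pairs of adjacent vertices of `|x u - g u v * x v| ^ 2`. -/
theorem IsUnitGain.eq_gain_mul_of_gainLaplacian_mulVec_eq_zero [Fintype V]
    (hg : IsUnitGain Γ g) {x : V → ℂ} (hx : gainLaplacian Γ g *ᵥ x = 0) {u v : V}
    (huv : Γ.Adj u v) : x u = g u v * x v := by
  set f : V → V → ℂ := fun u v =>
    if Γ.Adj u v then star (x u) * (x u - g u v * x v) else 0 with hf
  have hf_sum : ∑ u, ∑ v, f u v = 0 := by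
    refine Finset.sum_eq_zero fun u _ => ?_
    have := congrFun hx u
    rw [hg.gainLaplacian_mulVec_apply] at this
    have h2 : ∑ v, f u v = star (x u) * ∑ v, if Γ.Adj u v then x u - g u v * x v else 0 := by
      rw [Finset.mul_sum]
      exact Finset.sum_congr rfl fun v _ => by simp only [hf]; split_ifs <;> simp
    rw [h2, this, Pi.zero_apply, mul_zero]
  have hterm : ∀ u v, ((if Γ.Adj u v then Complex.normSq (x u - g u v * x v) else 0 : ℝ) : ℂ)
      = f u v + f v u := by
    intro u v
    by_cases h : Γ.Adj u v
    · have h1 := hg.mul_symm u v h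
      have h2 := hg.star_apply u v
      simp only [hf, if_pos h, if_pos h.symm]
      rw [← Complex.mul_conj, starRingEnd_apply, star_sub, star_mul', h2]
      linear_combination (x v * star (x v)) * h1
    · have h' : ¬ Γ.Adj v u := fun h' => h h'.symm
      simp [hf, h, h']
  have hsum : ∑ u, ∑ v, (if Γ.Adj u v then Complex.normSq (x u - g u v * x v) else 0) = 0 := by
    apply Complex.ofReal_injective
    push_cast [Complex.ofReal_sum]
    have : ∑ u, ∑ v, (f u v + f v u) = 0 := by
      simp only [Finset.sum_add_distrib]
      rw [Finset.sum_comm (f := fun u v => f v u), hf_sum, add_zero]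
    rw [← this]
    exact Finset.sum_congr rfl fun u _ => Finset.sum_congr rfl fun v _ => by
      rw [← hterm]
  have hnn : ∀ u v, 0 ≤ (if Γ.Adj u v then Complex.normSq (x u - g u v * x v) else 0) := by
    intro u v
    split_ifs
    exacts [Complex.normSq_nonneg _, le_rfl]
  have hu := (Finset.sum_eq_zero_iff_of_nonneg fun u _ =>
    Finset.sum_nonneg fun v _ => hnn u v).1 hsum u (Finset.mem_univ u)
  have hv := (Finset.sum_eq_zero_iff_of_nonneg fun v _ => hnn u v).1 hu v (Finset.mem_univ v)
  rw [if_pos huv, Complex.normSq_eq_zero] at hv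
  exact sub_eq_zero.1 hv

theorem eq_walkGain_mul {x : V → ℂ} (hx : ∀ u v, Γ.Adj u v → x u = g u v * x v) {u v : V}
    (p : Γ.Walk u v) : x u = walkGain g p * x v := by
  induction p with
  | nil => simp [walkGain]
  | cons h p ih => rw [walkGain, mul_assoc, ← ih]; exact hx _ _ h

theorem IsUnitGain.walkGain_eq_one_of_det_eq_zero [Fintype V] [DecidableEq V]
    (hg : IsUnitGain Γ g) (hΓ : Γ.Connected) (hdet : (gainLaplacian Γ g).det = 0) {v : V}
    (p : Γ.Walk v v) : walkGain g p = 1 := by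
  obtain ⟨x, hx0, hx⟩ := exists_mulVec_eq_zero_iff.2 hdet
  have hedge := fun u v => hg.eq_gain_mul_of_gainLaplacian_mulVec_eq_zero hx (u := u) (v := v)
  have hv : x v ≠ 0 := by
    intro hv
    refine hx0 (funext fun u => ?_)
    obtain ⟨q⟩ := hΓ.preconnected u v
    rw [eq_walkGain_mul hedge q, hv, mul_zero, Pi.zero_apply]
  exact mul_right_cancel₀ hv ((eq_walkGain_mul hedge p).symm.trans (one_mul _).symm)

/-- If all cycles have gain `1`, then the gains of the walks to a fixed root form a kernel vector
of the Laplacian, supported on the component of the root. -/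
theorem IsUnitGain.det_gainLaplacian_eq_zero [Fintype V] [DecidableEq V] [Nonempty V]
    (hg : IsUnitGain Γ g)
    (hc : ∀ (v : V) (C : Γ.Walk v v), C.IsCycle → walkGain g C = 1) :
    (gainLaplacian Γ g).det = 0 := by
  classical
  obtain ⟨r⟩ := ‹Nonempty V›
  set x : V → ℂ := fun v => if h : Γ.Reachable v r then walkGain g h.some else 0 with hx
  have hwalk : ∀ {v : V} (p : Γ.Walk v r), x v = walkGain g p := fun p => by
    simp only [hx, dif_pos p.reachable]
    exact hg.walkGain_eq_of_forall_isCycle hc _ _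
  have hedge : ∀ u v, Γ.Adj u v → x u = g u v * x v := by
    intro u v h
    by_cases hv : Γ.Reachable v r
    · obtain ⟨p⟩ := hv
      rw [hwalk p, hwalk (.cons h p), walkGain]
    · have hu : ¬ Γ.Reachable u r := fun hu => hv (h.symm.reachable.trans hu)
      simp [hx, hu, hv]
  refine exists_mulVec_eq_zero_iff.1 ⟨x, fun h0 => ?_, funext fun u => ?_⟩
  · have hr := hwalk (.nil : Γ.Walk r r)
    rw [h0, walkGain] at hr
    exact zero_ne_one hr
  · rw [hg.gainLaplacian_mulVec_apply]
    refine Finset.sum_eq_zero fun v _ => ?_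
    split_ifs with h
    exacts [sub_eq_zero.2 (hedge u v h), rfl]

end Gain

/-! ### The gains of a mixed graph -/

namespace MixedGraph

variable {V : Type*} (G : MixedGraph V)

theorem hermitianAdj_of_arc {u v : V} (h : G.Arc u v) : G.hermitianAdj u v = Complex.I := by
  simp [hermitianAdj, h]

theorem hermitianAdj_of_arc_symm {u v : V} (h : G.Arc v u) :
    G.hermitianAdj u v = -Complex.I := by
  simp [hermitianAdj, h, G.not_arc_symm v u h]

theorem hermitianAdj_of_unoriented {u v : V} (h : G.Unoriented u v) :
    G.hermitianAdj u v = 1 := by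
  simp [hermitianAdj, h, h.2.1, h.2.2]

theorem unoriented_symm {u v : V} (h : G.Unoriented u v) : G.Unoriented v u :=
  ⟨h.1.symm, h.2.2, h.2.1⟩

theorem arc_or_arc_or_unoriented {u v : V} (h : G.graph.Adj u v) :
    G.Arc u v ∨ G.Arc v u ∨ G.Unoriented u v := by
  by_cases h1 : G.Arc u v
  · exact .inl h1
  by_cases h2 : G.Arc v u
  exacts [.inr (.inl h2), .inr (.inr ⟨h, h1, h2⟩)]

theorem hermitianAdj_eq_zero {u v : V} (h : ¬ G.graph.Adj u v) : G.hermitianAdj u v = 0 := by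
  have h1 : ¬ G.Arc u v := fun h1 => h (G.adj_of_arc u v h1)
  have h2 : ¬ G.Arc v u := fun h2 => h (G.adj_of_arc v u h2).symm
  have h3 : ¬ G.Unoriented u v := fun h3 => h h3.1
  simp [hermitianAdj, h1, h2, h3]

theorem isUnitGain_hermitianAdj : IsUnitGain G.graph G.hermitianAdj where
  star_apply u v := by
    by_cases h : G.graph.Adj u v
    · rcases G.arc_or_arc_or_unoriented h with h | h | h
      · simp [G.hermitianAdj_of_arc h, G.hermitianAdj_of_arc_symm h]
      · simp [G.hermitianAdj_of_arc h, G.hermitianAdj_of_arc_symm h]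
      · simp [G.hermitianAdj_of_unoriented h,
          G.hermitianAdj_of_unoriented (G.unoriented_symm h)]
    · rw [G.hermitianAdj_eq_zero h, G.hermitianAdj_eq_zero fun h' => h h'.symm, star_zero]
  mul_symm u v h := by
    rcases G.arc_or_arc_or_unoriented h with h | h | h
    · simp [G.hermitianAdj_of_arc h, G.hermitianAdj_of_arc_symm h]
    · simp [G.hermitianAdj_of_arc h, G.hermitianAdj_of_arc_symm h]
    · simp [G.hermitianAdj_of_unoriented h,
        G.hermitianAdj_of_unoriented (G.unoriented_symm h)]
  eq_zero _ _ := G.hermitianAdj_eq_zero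

theorem isUnitGain_neg_hermitianAdj : IsUnitGain G.graph (-G.hermitianAdj) where
  star_apply u v := by
    simpa using G.isUnitGain_hermitianAdj.star_apply u v
  mul_symm u v h := by
    simpa using G.isUnitGain_hermitianAdj.mul_symm u v h
  eq_zero u v h := by
    simpa using G.hermitianAdj_eq_zero h

theorem laplacian_eq_gainLaplacian [Fintype V] :
    G.laplacian = gainLaplacian G.graph G.hermitianAdj := rfl

theorem quasiLaplacian_eq_gainLaplacian [Fintype V] :
    G.quasiLaplacian = gainLaplacian G.graph (-G.hermitianAdj) := by
  rw [gainLaplacian, sub_neg_eq_add]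
  rfl

theorem walkGain_hermitianAdj {u v : V} (p : G.graph.Walk u v) :
    walkGain G.hermitianAdj p =
      Complex.I ^ ((G.forwardCount p : ℤ) - G.backwardCount p) := by
  induction p with
  | nil => simp [walkGain, forwardCount, backwardCount]
  | @cons u w v h p ih =>
    rw [walkGain, ih]
    simp only [forwardCount, backwardCount, Walk.darts_cons, List.countP_cons]
    rcases G.arc_or_arc_or_unoriented h with h | h | h
    · rw [G.hermitianAdj_of_arc h, ← zpow_one_add₀ Complex.I_ne_zero]
      simp only [h, G.not_arc_symm _ _ h]
      congr 1
      push_cast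
      simp
      ring
    · rw [G.hermitianAdj_of_arc_symm h, ← Complex.inv_I, ← _root_.zpow_neg_one,
        ← zpow_add₀ Complex.I_ne_zero]
      simp only [h, G.not_arc_symm _ _ h]
      congr 1
      push_cast
      simp
      ring
    · simp [G.hermitianAdj_of_unoriented h, h.2.1, h.2.2]

theorem walkGain_neg_hermitianAdj {u v : V} (p : G.graph.Walk u v) :
    walkGain (-G.hermitianAdj) p =
      Complex.I ^ ((G.backwardCount p : ℤ) - G.forwardCount p + 2 * G.unorientedCount p) := by
  induction p with
  | nil => simp [walkGain, forwardCount, backwardCount, unorientedCount]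
  | @cons u w v h p ih =>
    rw [walkGain, ih, Matrix.neg_apply]
    simp only [forwardCount, backwardCount, unorientedCount, Walk.darts_cons, List.countP_cons]
    rcases G.arc_or_arc_or_unoriented h with h | h | h
    · have hu : ¬ G.Unoriented u w := fun hu => hu.2.1 h
      rw [G.hermitianAdj_of_arc h, ← Complex.inv_I, ← _root_.zpow_neg_one,
        ← zpow_add₀ Complex.I_ne_zero]
      simp only [h, hu, G.not_arc_symm _ _ h]
      congr 1
      push_cast
      simp
      ring
    · have hu : ¬ G.Unoriented u w := fun hu => hu.2.2 h
      rw [G.hermitianAdj_of_arc_symm h, neg_neg, ← zpow_one_add₀ Complex.I_ne_zero]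
      simp only [h, hu, G.not_arc_symm _ _ h]
      congr 1
      push_cast
      simp
      ring
    · have hI : (-1 : ℂ) = Complex.I ^ (2 : ℤ) := by
        rw [show (2 : ℤ) = ((2 : ℕ) : ℤ) from rfl, zpow_natCast, Complex.I_sq]
      rw [G.hermitianAdj_of_unoriented h, hI, ← zpow_add₀ Complex.I_ne_zero]
      simp only [h, h.2.1, h.2.2]
      congr 1
      push_cast
      simp
      ring

theorem isTypeV_iff {v : V} (C : G.graph.Walk v v) :
    walkGain G.hermitianAdj C = 1 ↔ G.IsTypeV C := by
  rw [walkGain_hermitianAdj, Complex.isPrimitiveRoot_I.zpow_eq_one_iff_dvd, IsTypeV, ← dvd_abs]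
  refine exists_congr fun k => ?_
  rw [div_eq_iff two_ne_zero]
  constructor
  · intro h
    have h' := congrArg (Int.cast : ℤ → ℚ) h
    push_cast at h'
    rw [h']
    ring
  · intro h
    have h' : ((|(G.forwardCount C : ℤ) - G.backwardCount C| : ℤ) : ℚ) = ((4 * k : ℤ) : ℚ) := by
      push_cast
      rw [h]
      ring
    exact_mod_cast h'

/-- The sign of `a - b` is immaterial: if `4` divides `b - a + 2 * c`, then `a - b` is even, so
that `a - b` and `b - a` agree modulo `4`. -/
theorem isTypeIII_iff {v : V} (C : G.graph.Walk v v) :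
    walkGain (-G.hermitianAdj) C = 1 ↔ G.IsTypeIII C := by
  rw [walkGain_neg_hermitianAdj, Complex.isPrimitiveRoot_I.zpow_eq_one_iff_dvd, IsTypeIII]
  have habs : ((4 : ℕ) : ℤ) ∣ (G.backwardCount C : ℤ) - G.forwardCount C + 2 * G.unorientedCount C
      ↔ (4 : ℤ) ∣ |(G.forwardCount C : ℤ) - G.backwardCount C| + 2 * G.unorientedCount C := by
    rcases abs_cases ((G.forwardCount C : ℤ) - G.backwardCount C) with h | h <;>
      rw [h.1] <;> omega
  rw [habs]
  refine exists_congr fun k => ?_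
  constructor
  · intro h
    have h' := congrArg (Int.cast : ℤ → ℚ) h
    push_cast at h'
    linear_combination h' / 2
  · intro h
    have h' : ((|(G.forwardCount C : ℤ) - G.backwardCount C| + 2 * G.unorientedCount C : ℤ) : ℚ)
        = ((4 * k : ℤ) : ℚ) := by
      push_cast
      linear_combination 2 * h
    exact_mod_cast h'

end MixedGraph

theorem mainTheorem9 {V : Type*} [Fintype V] [DecidableEq V] [Nonempty V] (G : MixedGraph V) :
    (G.graph.Connected →
      (G.quasiLaplacian.det = 0 ↔ G.AllCyclesTypeIII) ∧
      (G.laplacian.det = 0 ↔ G.AllCyclesTypeV)) ∧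
    (G.AllCyclesTypeIII → G.quasiLaplacian.det = 0) ∧
    (G.AllCyclesTypeV → G.laplacian.det = 0) := by
  have hV : G.AllCyclesTypeV → G.laplacian.det = 0 := fun h => by
    rw [G.laplacian_eq_gainLaplacian]
    exact G.isUnitGain_hermitianAdj.det_gainLaplacian_eq_zero fun v C hC =>
      (G.isTypeV_iff C).2 (h v C hC)
  have hIII : G.AllCyclesTypeIII → G.quasiLaplacian.det = 0 := fun h => by
    rw [G.quasiLaplacian_eq_gainLaplacian]
    exact G.isUnitGain_neg_hermitianAdj.det_gainLaplacian_eq_zero fun v C hC =>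
      (G.isTypeIII_iff C).2 (h v C hC)
  refine ⟨fun hG => ⟨⟨fun hdet v C _ => ?_, hIII⟩, ⟨fun hdet v C _ => ?_, hV⟩⟩, hIII, hV⟩
  · rw [G.quasiLaplacian_eq_gainLaplacian] at hdet
    exact (G.isTypeIII_iff C).1
      (G.isUnitGain_neg_hermitianAdj.walkGain_eq_one_of_det_eq_zero hG hdet C)
  · rw [G.laplacian_eq_gainLaplacian] at hdet
    exact (G.isTypeV_iff C).1
      (G.isUnitGain_hermitianAdj.walkGain_eq_one_of_det_eq_zero hG hdet C)
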